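/- All graphs are finite and simple, with at least one vertex. The density of a graph $G$ is $\rho(G)=e(G)/v(G)$, its number of edges divided by its number of vertices. A class of graphs is minor-closed if it contains every minor of each of its members, and proper if it is non-empty and does not contain all graphs; its critical density is $\beta_{\mathcal A}=\sup_{G\in\mathcal A}\rho(G)$. A graph $G$ is minor-balanced if $\rho(H)\le\rho(G)$ for every minor $H$ of $G$, and a real number is achievable if it equals $\rho(G)$ for some minor-balanced graph $G$. Theorem 4. Let $k\ge 2$ be an integer. (a) Let $\mathcal A$ be a proper minor-closed class of graphs with $$2-\frac1{k-1}\le\beta_{\mathcal A}<2-\frac1k .$$ Then either $\beta_{\mathcal A}=2-\frac1{k-1}$, or $$\beta_{\mathcal A}=2-\frac1k-\frac{2k-t-1}{kn}$$ for some integers $n,m,t$ with $n=mk+1+t$, $m\ge1$, $0\le t\le k-1$ and $n>(2k-1-t)(k-1)$. (b) Each of these values is achievable: the number $2-\frac1{k-1}$ is achievable, and for all integers $n,m,t$ with $n=mk+1+t$, $m\ge1$, $0\le t\le k-1$ and $n>(2k-1-t)(k-1)$ the number $2-\frac1k-\frac{2k-t-1}{kn}$ is achievable. -/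

import Mathlib

/-- A finite simple graph with at least one vertex. -/
structure FiniteGraph where
  /-- the vertex set -/
  V : Type
  [finite : Finite V]
  [nonempty : Nonempty V]
  /-- the adjacency structure -/
  graph : SimpleGraph V

attribute [instance] FiniteGraph.finite FiniteGraph.nonempty

namespace FiniteGraph

/-- The density `ρ(G) = e(G) / v(G)`, the number of edges per vertex. -/
noncomputable def density (G : FiniteGraph) : ℝ :=
  (G.graph.edgeSet.ncard : ℝ) / (Nat.card G.V : ℝ)

/-- `H` is a minor of `G`: there are pairwise disjoint sets of vertices of `G`, one for each vertex
of `H`, each inducing a (nonempty) connected subgraph of `G`, such that adjacent vertices of `H`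
have sets joined by an edge of `G`. Contracting each of these sets to a single vertex, in a suitable
subgraph of `G`, yields a copy of `H`. -/
def IsMinor (H G : FiniteGraph) : Prop :=
  ∃ B : H.V → Set G.V,
    (∀ x, (G.graph.induce (B x)).Connected) ∧
    (∀ x y, x ≠ y → Disjoint (B x) (B y)) ∧
    (∀ x y, H.graph.Adj x y → ∃ u ∈ B x, ∃ v ∈ B y, G.graph.Adj u v)

/-- A graph is minor-balanced if each of its minors has density at most its own. -/
def IsMinorBalanced (G : FiniteGraph) : Prop :=
  ∀ H : FiniteGraph, H.IsMinor G → H.density ≤ G.density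

/-- A class of graphs is minor-closed if it contains every minor of each of its members. In
particular it is then closed under isomorphism. -/
def IsMinorClosed (A : Set FiniteGraph) : Prop :=
  ∀ G ∈ A, ∀ H : FiniteGraph, H.IsMinor G → H ∈ A

/-- A class of graphs is proper if it is nonempty and does not contain all graphs. -/
def IsProper (A : Set FiniteGraph) : Prop :=
  A.Nonempty ∧ A ≠ Set.univ

/-- The critical density of a class, the supremum of the densities of its members. (As a real
supremum it is `0` when the densities are unbounded, so a class for which it is at least `1` has
bounded densities and this is the genuine supremum.) -/
noncomputable def criticalDensity (A : Set FiniteGraph) : ℝ :=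
  sSup (density '' A)

/-- The set of achievable densities, that is, the densities of minor-balanced graphs. -/
def achievableDensities : Set ℝ :=
  {β | ∃ G : FiniteGraph, G.IsMinorBalanced ∧ G.density = β}

end FiniteGraph

/-!
The set of parametrized values is best described as follows: it is the set of all fractions `e / v`
strictly between `2 - 1/(k-1)` and `2 - 1/k` with `e ≥ (2 - 1/k) (v - 1)`. Indeed, if
`d = (2k-1) v - k e` is between `1` and `2k - 1`, one may scale `e` and `v` by an `r` with
`k ≤ d r ≤ 2k - 1`, and the scaled fraction has the required shape with `t = 2k - 1 - d r`
(`exists_params`).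

To bring a critical density into this set, let `H` be a member of the class with the fewest vertices
among those of density at least some `c > 2 - 1/(k-1)`. By minimality, contracting a connected set
`Z` with `|Z| ≤ k` loses more than `c (|Z| - 1)` edges, hence at least `2 (|Z| - 1)`. Consider a
maximal vertex set `X` with `k e(X) ≥ (2k-1) (|X| - 1)`, and suppose that it is not the whole vertex
set. An edge `uy` leaves `X`, again by minimality. Grow a set `Z` from `{u, y}` by adding vertices
with two neighbours in `Z`, so that `e(Z) ≥ 2 |Z| - 3` throughout and `Z` meets `X` only in `u`. As
long as `|Z| ≤ k`, another such vertex exists: otherwise contracting `Z` would lose only the `e(Z)`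
edges inside it, so that `e(Z) ≥ 2 (|Z| - 1)`, and `X ∪ Z` would contradict the maximality of `X`.
When `|Z| = k + 1`, the set `X ∪ Z` contradicts it as well. So `X` is the whole vertex set, and `e ≥
(2 - 1/k) (v - 1)` for `H` (`card_edgesIn_univ_ge`, `card_edges_ge_of_minimal`). Densities of such
graphs accumulate only at `2 - 1/k`, so that a critical density below this number is attained by one
of them (`IsMinorClosed.exists_density_eq`).

The values are achieved by the join of a vertex with a disjoint union of paths: a single path on
`3 (k-1) - 1` vertices for `2 - 1/(k-1)`, and otherwise `m - 1` paths on `k` vertices together with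
one on `k + t` vertices. A minor of such a graph is, apart from one vertex, a linear forest
that fits into the paths, and counting its edges shows that no minor is denser
(`IsMinor.pathFan_count`, `IsMinor.density_le_pathFan`).
-/

/-! ### Edges inside a vertex set -/

namespace SimpleGraph

variable {V : Type*}

/-- The edges of `G` with both ends in `X`. -/
noncomputable def edgesIn (G : SimpleGraph V) (X : Finset V) : Finset (Sym2 V) :=
  open Classical in {e ∈ X.sym2 | e ∈ G.edgeSet}

theorem mem_edgesIn {G : SimpleGraph V} {X : Finset V} {a b : V} :
    s(a, b) ∈ G.edgesIn X ↔ (a ∈ X ∧ b ∈ X) ∧ G.Adj a b := by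
  simp [edgesIn]

theorem edgesIn_mono (G : SimpleGraph V) {X Y : Finset V} (h : X ⊆ Y) :
    G.edgesIn X ⊆ G.edgesIn Y := by
  intro e
  induction e with | _ a b =>
  simp only [mem_edgesIn]
  exact fun ⟨⟨ha, hb⟩, hab⟩ => ⟨⟨h ha, h hb⟩, hab⟩

theorem disjoint_edgesIn [DecidableEq V] (G : SimpleGraph V) {X Z : Finset V} {u : V}
    (h : X ∩ Z = {u}) : Disjoint (G.edgesIn X) (G.edgesIn Z) := by
  rw [Finset.disjoint_left]
  intro e
  induction e with | _ a b =>
  simp only [mem_edgesIn]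
  rintro ⟨⟨haX, hbX⟩, hab⟩ ⟨⟨haZ, hbZ⟩, -⟩
  have ha : a ∈ X ∩ Z := Finset.mem_inter.2 ⟨haX, haZ⟩
  have hb : b ∈ X ∩ Z := Finset.mem_inter.2 ⟨hbX, hbZ⟩
  rw [h, Finset.mem_singleton] at ha hb
  exact hab.ne (ha.trans hb.symm)

theorem card_edgesIn_add_le_union [DecidableEq V] (G : SimpleGraph V) {X Z : Finset V} {u : V}
    (h : X ∩ Z = {u}) :
    (G.edgesIn X).card + (G.edgesIn Z).card ≤ (G.edgesIn (X ∪ Z)).card := by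
  classical
  rw [← Finset.card_union_of_disjoint (G.disjoint_edgesIn h)]
  exact Finset.card_le_card (Finset.union_subset (G.edgesIn_mono Finset.subset_union_left)
    (G.edgesIn_mono Finset.subset_union_right))

theorem card_edgesIn_add_lt_union [DecidableEq V] (G : SimpleGraph V) {X Z : Finset V} {u : V}
    (h : X ∩ Z = {u}) {x z : V} (hx : x ∈ X) (hxZ : x ∉ Z) (hz : z ∈ Z) (hzX : z ∉ X)
    (hxz : G.Adj x z) :
    (G.edgesIn X).card + (G.edgesIn Z).card < (G.edgesIn (X ∪ Z)).card := by
  classical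
  rw [← Finset.card_union_of_disjoint (G.disjoint_edgesIn h)]
  refine Finset.card_lt_card (Finset.ssubset_iff_of_subset (Finset.union_subset
    (G.edgesIn_mono Finset.subset_union_left)
    (G.edgesIn_mono Finset.subset_union_right)) |>.2 ⟨s(x, z), ?_, ?_⟩)
  · simp [mem_edgesIn, hx, hz, hxz]
  · simp [mem_edgesIn, hxZ, hzX]

theorem card_edgesIn_insert [DecidableEq V] (G : SimpleGraph V) {X : Finset V} {z a b : V}
    (hz : z ∉ X) (ha : a ∈ X) (hb : b ∈ X) (hab : a ≠ b) (hza : G.Adj z a) (hzb : G.Adj z b) :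
    (G.edgesIn X).card + 2 ≤ (G.edgesIn (insert z X)).card := by
  classical
  have hne : s(z, a) ≠ s(z, b) := fun h => hab (Sym2.congr_right.1 h)
  have hdis : Disjoint (G.edgesIn X) {s(z, a), s(z, b)} := by
    simp [mem_edgesIn, hz]
  rw [← Finset.card_pair hne, ← Finset.card_union_of_disjoint hdis]
  refine Finset.card_le_card (Finset.union_subset
    (G.edgesIn_mono (Finset.subset_insert _ _)) ?_)
  intro e he
  simp only [Finset.mem_insert, Finset.mem_singleton] at he
  rcases he with rfl | rfl <;> simp [mem_edgesIn, ha, hb, hza, hzb]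

theorem edgeSet_ncard_eq_card_edgesIn [Fintype V] (G : SimpleGraph V) :
    G.edgeSet.ncard = (G.edgesIn Finset.univ).card := by
  rw [← Set.ncard_coe_finset]
  congr 1
  ext e
  simp [edgesIn]

/-! ### The extremal argument -/

/-- A piece that can be glued to a vertex `u` of a maximal set `X` with
`(2k - 1)(|X| - 1) ≤ k e(X)`: it is grown from an edge `uy` leaving `X` by repeatedly adding a vertex
with two neighbours in the piece. Such a vertex exists because contracting the piece
would otherwise lose too few edges, and it is not in `X` because the union with `X` would
otherwise contradict the maximality of `X`. -/
theorem exists_glued_piece [DecidableEq V] {G : SimpleGraph V} {k : ℕ} (hk : 2 ≤ k)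
    (hcontr : ∀ Z : Finset V, (G.induce (Z : Set V)).Connected → 2 ≤ Z.card → Z.card ≤ k →
      (∀ z ∉ Z, ∀ a ∈ Z, ∀ b ∈ Z, G.Adj z a → G.Adj z b → a = b) →
      2 * (Z.card - 1) ≤ (G.edgesIn Z).card)
    {X : Finset V} (hX : (2 * k - 1) * X.card ≤ k * (G.edgesIn X).card + (2 * k - 1))
    (hmax : ∀ Y, X ⊂ Y → k * (G.edgesIn Y).card + (2 * k - 1) < (2 * k - 1) * Y.card)
    {u y : V} (hu : u ∈ X) (hy : y ∉ X) (huy : G.Adj u y) (j : ℕ) (hj : 1 ≤ j) (hjk : j ≤ k) :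
    ∃ Z : Finset V, Z.card = j + 1 ∧ X ∩ Z = {u} ∧ (G.induce (Z : Set V)).Connected ∧
      2 * j ≤ (G.edgesIn Z).card + 1 := by
  induction j, hj using Nat.le_induction with
  | base =>
    refine ⟨{u, y}, Finset.card_pair huy.ne, ?_, ?_, ?_⟩
    · ext v
      simp only [Finset.mem_inter, Finset.mem_insert, Finset.mem_singleton]
      constructor
      · rintro ⟨hv, rfl | rfl⟩
        · rfl
        · exact absurd hv hy
      · rintro rfl
        exact ⟨hu, Or.inl rfl⟩
    · rw [Finset.coe_pair]
      exact induce_pair_connected_of_adj huy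
    · have : 0 < (G.edgesIn {u, y}).card :=
        Finset.card_pos.2 ⟨s(u, y), by simp [mem_edgesIn, huy]⟩
      omega
  | succ j hj ih =>
    obtain ⟨Z, hZ, hXZ, hconn, he⟩ := ih (by omega)
    obtain ⟨q, rfl⟩ : ∃ q, k = q + 1 := ⟨k - 1, by omega⟩
    have hk' : 2 * (q + 1) - 1 = 2 * q + 1 := rfl
    rw [hk'] at hX hmax
    have huXZ : u ∈ X ∩ Z := by simp [hXZ]
    have huZ : u ∈ Z := (Finset.mem_inter.1 huXZ).2
    have hcard : (X ∪ Z).card = X.card + j := by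
      have := Finset.card_union_add_card_inter X Z
      rw [hXZ, Finset.card_singleton] at this
      omega
    have hss : X ⊂ X ∪ Z := by
      refine Finset.ssubset_iff_subset_ne.2 ⟨Finset.subset_union_left, fun h => ?_⟩
      rw [← h] at hcard
      omega
    -- The piece adds `j` vertices to `X`, so it must add fewer than `2 * j` edges.
    have hfew : (G.edgesIn (X ∪ Z)).card < (G.edgesIn X).card + 2 * j := by
      have := hmax _ hss
      rw [hcard] at this
      by_contra! hge
      nlinarith
    have heZ : ¬ 2 * (Z.card - 1) ≤ (G.edgesIn Z).card := by
      have := G.card_edgesIn_add_le_union hXZ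
      omega
    have hex := mt (hcontr Z hconn (by omega) (by omega)) heZ
    push Not at hex
    obtain ⟨z, hzZ, a, ha, b, hb, hza, hzb, hab⟩ := hex
    have hzX : z ∉ X := by
      intro hzX
      obtain ⟨c, hc, hzc, hcu⟩ : ∃ c ∈ Z, G.Adj z c ∧ c ≠ u := by
        by_cases hau : a = u
        · exact ⟨b, hb, hzb, fun h => hab (hau.trans h.symm)⟩
        · exact ⟨a, ha, hza, hau⟩
      have hcX : c ∉ X := fun h => hcu <| by
        have : c ∈ X ∩ Z := Finset.mem_inter.2 ⟨h, hc⟩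
        simpa [hXZ] using this
      have := G.card_edgesIn_add_lt_union hXZ hzX hzZ hc hcX hzc
      omega
    refine ⟨insert z Z, by simp [hzZ, hZ], ?_, ?_, ?_⟩
    · rw [Finset.inter_insert_of_notMem hzX, hXZ]
    · have h1 := induce_union_connected (G := G) (s := (Z : Set V)) (t := {a, z}) hconn.preconnected
        (induce_pair_connected_of_adj hza.symm).preconnected ⟨a, by simp [ha]⟩
      have h2 : ((insert z Z : Finset V) : Set V) = (Z : Set V) ∪ {a, z} := by
        ext v
        simp only [Finset.coe_insert, Set.mem_insert_iff, Set.mem_union, Set.mem_singleton_iff]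
        constructor
        · tauto
        · rintro (h | rfl | h)
          · exact Or.inr h
          · exact Or.inr ha
          · exact Or.inl h
      rw [h2]
      exact h1
    · have := G.card_edgesIn_insert hzZ ha hb hab hza hzb
      omega

/-- The extremal argument behind the description of the critical densities: if every proper set of
vertices is left by an edge, and contracting a connected set `Z` of at most `k` vertices loses at
least `2 (|Z| - 1)` edges, then `e ≥ (2 - 1/k) (v - 1)`. -/
theorem card_edgesIn_univ_ge [Fintype V] [Nonempty V] {G : SimpleGraph V} {k : ℕ} (hk : 2 ≤ k)
    (hleave : ∀ X : Finset V, X.Nonempty → X ≠ Finset.univ → ∃ u ∈ X, ∃ y ∉ X, G.Adj u y)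
    (hcontr : ∀ Z : Finset V, (G.induce (Z : Set V)).Connected → 2 ≤ Z.card → Z.card ≤ k →
      (∀ z ∉ Z, ∀ a ∈ Z, ∀ b ∈ Z, G.Adj z a → G.Adj z b → a = b) →
      2 * (Z.card - 1) ≤ (G.edgesIn Z).card) :
    (2 * k - 1) * Fintype.card V ≤ k * (G.edgesIn Finset.univ).card + (2 * k - 1) := by
  classical
  let S : Finset (Finset V) := {X | X.Nonempty ∧
    (2 * k - 1) * X.card ≤ k * (G.edgesIn X).card + (2 * k - 1)}
  have hS : S.Nonempty := ⟨{Classical.arbitrary V}, by simp [S]⟩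
  obtain ⟨X, hXmax⟩ := S.exists_maximal hS
  have hXS := hXmax.prop
  simp only [S, Finset.mem_filter, Finset.mem_univ, true_and] at hXS
  by_cases hXu : X = Finset.univ
  · rw [← Finset.card_univ, ← hXu]
    exact hXS.2
  exfalso
  have hmax : ∀ Y, X ⊂ Y → k * (G.edgesIn Y).card + (2 * k - 1) < (2 * k - 1) * Y.card := by
    intro Y hY
    by_contra! h
    exact hXmax.not_prop_of_gt hY (by simp [S, h, hXS.1.mono hY.subset])
  obtain ⟨u, hu, y, hy, huy⟩ := hleave X hXS.1 hXu
  obtain ⟨Z, hZ, hXZ, -, he⟩ :=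
    exists_glued_piece hk hcontr hXS.2 hmax hu hy huy k (by omega) le_rfl
  have hcard : (X ∪ Z).card = X.card + k := by
    have := Finset.card_union_add_card_inter X Z
    rw [hXZ, Finset.card_singleton] at this
    omega
  have hss : X ⊂ X ∪ Z := by
    refine Finset.ssubset_iff_subset_ne.2 ⟨Finset.subset_union_left, fun h => ?_⟩
    rw [← h] at hcard
    omega
  have h1 := hmax _ hss
  have h2 := G.card_edgesIn_add_le_union hXZ
  rw [hcard] at h1
  have h3 : 2 * k - 1 ≤ (G.edgesIn Z).card := by omega
  have h4 := Nat.mul_le_mul_left k (h2.trans' (Nat.add_le_add_left h3 _))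
  have h5 := hXS.2
  rw [mul_add, mul_comm k (2 * k - 1)] at h4
  rw [mul_add] at h1
  omega

/-! ### Connected induced subgraphs -/

theorem induce_singleton_connected (G : SimpleGraph V) (v : V) :
    (G.induce {v}).Connected :=
  (connected_iff _).2 ⟨Preconnected.of_subsingleton, inferInstance⟩

theorem Connected.induce_induction {G : SimpleGraph V} {S : Set V}
    (h : (G.induce S).Connected) {P : V → Prop} {a : V} (ha : a ∈ S) (hPa : P a)
    (hP : ∀ u ∈ S, ∀ v ∈ S, G.Adj u v → P u → P v) : ∀ b ∈ S, P b := by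
  intro b hb
  obtain ⟨w⟩ := h.preconnected ⟨a, ha⟩ ⟨b, hb⟩
  suffices ∀ x y : S, (G.induce S).Walk x y → P x → P y from this _ _ w hPa
  intro x y w
  induction w with
  | nil => exact id
  | cons hadj _ ih => exact fun hx => ih (hP _ (Subtype.coe_prop _) _ (Subtype.coe_prop _) hadj hx)

end SimpleGraph

/-! ### Minors by contraction -/

namespace FiniteGraph

/-- The graph obtained from a family of branch sets by contracting each of them to a vertex and
deleting all vertices outside of them. -/
def contract (G : FiniteGraph) {W : Type} [Finite W] [Nonempty W] (B : W → Set G.V) :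
    FiniteGraph where
  V := W
  graph :=
    { Adj := fun a b => a ≠ b ∧ ∃ u ∈ B a, ∃ v ∈ B b, G.graph.Adj u v
      symm := ⟨fun _ _ ⟨hne, u, hu, v, hv, huv⟩ => ⟨hne.symm, v, hv, u, hu, huv.symm⟩⟩
      loopless := ⟨fun _ h => h.1 rfl⟩ }

theorem isMinor_contract (G : FiniteGraph) {W : Type} [Finite W] [Nonempty W] (B : W → Set G.V)
    (hconn : ∀ x, (G.graph.induce (B x)).Connected)
    (hdis : ∀ x y, x ≠ y → Disjoint (B x) (B y)) : (G.contract B).IsMinor G :=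
  ⟨B, hconn, hdis, fun _ _ h => h.2⟩

/-- Contracting a connected set `Z` such that no outside vertex has two neighbours in `Z` loses
only the edges inside `Z`. -/
theorem exists_minor_contract_finset (G : FiniteGraph) (Z : Finset G.V)
    (hconn : (G.graph.induce (Z : Set G.V)).Connected)
    (hZ : ∀ z ∉ Z, ∀ a ∈ Z, ∀ b ∈ Z, G.graph.Adj z a → G.graph.Adj z b → a = b) :
    ∃ H : FiniteGraph, H.IsMinor G ∧ Nat.card H.V + Z.card = Nat.card G.V + 1 ∧
      G.graph.edgeSet.ncard ≤ H.graph.edgeSet.ncard + (G.graph.edgesIn Z).card := by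
  classical
  let B : Option {v : G.V // v ∉ Z} → Set G.V := fun x => x.elim (Z : Set G.V) (fun v => {v.1})
  let π : G.V → Option {v : G.V // v ∉ Z} := fun v => if h : v ∈ Z then none else some ⟨v, h⟩
  have hπ : ∀ v, v ∈ B (π v) := by
    intro v
    by_cases h : v ∈ Z <;> simp [B, π, h]
  have hB : ∀ x v, v ∈ B x → π v = x := by
    rintro (_ | ⟨w, hw⟩) v hv
    · simpa [B, π] using hv
    · obtain rfl : v = w := by simpa [B] using hv
      simp [π, hw]
  have hπ_eq : ∀ v w, π v = π w → v = w ∨ v ∈ Z ∧ w ∈ Z := by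
    intro v w h
    by_cases hv : v ∈ Z <;> by_cases hw : w ∈ Z <;> simp [π, hv, hw] at h ⊢
    exact h
  refine ⟨G.contract B, G.isMinor_contract B ?_ ?_, ?_, ?_⟩
  · rintro (_ | v)
    · exact hconn
    · exact G.graph.induce_singleton_connected v.1
  · intro x y hxy
    rw [Set.disjoint_left]
    intro v hx hy
    exact hxy ((hB x v hx).symm.trans (hB y v hy))
  · change Nat.card (Option {v : G.V // v ∉ Z}) + _ = _
    have := Fintype.ofFinite G.V
    have hle := Finset.card_le_univ Z
    rw [Nat.card_eq_fintype_card, Nat.card_eq_fintype_card, Fintype.card_option,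
      Fintype.card_subtype_compl (· ∈ Z), Fintype.card_coe]
    omega
  · have hsub : (G.graph.edgeSet \ (G.graph.edgesIn Z : Set (Sym2 G.V))).ncard ≤
        (G.contract B).graph.edgeSet.ncard := by
      have := (G.contract B).finite
      refine Set.ncard_le_ncard_of_injOn (Sym2.map π) ?_ ?_ (Set.toFinite _)
      · intro e
        induction e with | _ a b =>
        rintro ⟨hab, hnot⟩
        rw [SimpleGraph.mem_edgeSet] at hab
        rw [Finset.mem_coe, SimpleGraph.mem_edgesIn] at hnot
        refine ⟨fun h => ?_, a, hπ a, b, hπ b, hab⟩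
        rcases hπ_eq a b h with h | h
        · exact hab.ne h
        · exact hnot ⟨h, hab⟩
      · have key : ∀ a b c d, G.graph.Adj a b → ¬ (a ∈ Z ∧ b ∈ Z) → G.graph.Adj c d →
            π a = π c → π b = π d → a = c := by
          intro a b c d hab hnot hcd hac hbd
          rcases hπ_eq a c hac with h | ⟨ha, hc⟩
          · exact h
          · rcases hπ_eq b d hbd with rfl | ⟨hb, -⟩
            · exact hZ b (fun hb => hnot ⟨ha, hb⟩) a ha c hc hab.symm hcd.symm
            · exact absurd ⟨ha, hb⟩ hnot
        intro e he f hf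
        induction e with | _ a b =>
        induction f with | _ c d =>
        simp only [Set.mem_sdiff, SimpleGraph.mem_edgeSet, Finset.mem_coe, SimpleGraph.mem_edgesIn,
          not_and] at he hf
        obtain ⟨hab, hnab⟩ := he
        obtain ⟨hcd, -⟩ := hf
        have hnab' : ¬ (a ∈ Z ∧ b ∈ Z) := fun h => hnab h hab
        have hnba : ¬ (b ∈ Z ∧ a ∈ Z) := fun h => hnab' h.symm
        intro hef
        rw [Sym2.eq_iff]
        rcases Sym2.eq_iff.1 (hef : s(π a, π b) = s(π c, π d)) with ⟨h1, h2⟩ | ⟨h1, h2⟩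
        · exact Or.inl ⟨key a b c d hab hnab' hcd h1 h2, key b a d c hab.symm hnba hcd.symm h2 h1⟩
        · exact Or.inr ⟨key a b d c hab hnab' hcd.symm h1 h2, key b a c d hab.symm hnba hcd h2 h1⟩
    have := Set.ncard_le_ncard_sdiff_add_ncard G.graph.edgeSet
      (G.graph.edgesIn Z : Set (Sym2 G.V)) (Set.toFinite _)
    rw [Set.ncard_coe_finset] at this
    omega

theorem exists_minor_induce (G : FiniteGraph) (X : Finset G.V) (hX : X.Nonempty) :
    ∃ H : FiniteGraph, H.IsMinor G ∧ Nat.card H.V = X.card ∧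
      (G.graph.edgesIn X).card ≤ H.graph.edgeSet.ncard := by
  have : Nonempty X := hX.to_subtype
  let B : X → Set G.V := fun v => {v.1}
  refine ⟨G.contract B, G.isMinor_contract B (fun v => G.graph.induce_singleton_connected v.1) ?_,
    ?_, ?_⟩
  · intro x y hxy
    exact Set.disjoint_singleton.2 (Subtype.val_injective.ne hxy)
  · change Nat.card X = _
    simp
  · rw [← Set.ncard_coe_finset]
    have := (G.contract B).finite
    refine le_trans ?_ (Set.ncard_image_le (f := Sym2.map (Subtype.val : X → G.V)) (Set.toFinite _))
    refine Set.ncard_le_ncard ?_ (Set.toFinite _)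
    intro e
    induction e with | _ a b =>
    rw [Finset.mem_coe, SimpleGraph.mem_edgesIn]
    rintro ⟨⟨ha, hb⟩, hab⟩
    refine ⟨s(⟨a, ha⟩, ⟨b, hb⟩), ⟨fun h => hab.ne (congrArg Subtype.val h), a, rfl, b, rfl, hab⟩, rfl⟩

/-! ### Minimal dense graphs and critical densities -/

theorem card_pos (G : FiniteGraph) : (0 : ℝ) < Nat.card G.V := by
  exact_mod_cast Nat.card_pos

theorem le_density_iff {G : FiniteGraph} {c : ℝ} :
    c ≤ G.density ↔ c * Nat.card G.V ≤ G.graph.edgeSet.ncard :=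
  le_div_iff₀ G.card_pos

theorem density_lt_iff {G : FiniteGraph} {c : ℝ} :
    G.density < c ↔ (G.graph.edgeSet.ncard : ℝ) < c * Nat.card G.V :=
  div_lt_iff₀ G.card_pos

/-- A graph of density at least `c > 2 - 1/(k-1)`, all of whose smaller minors have density less
than `c`, satisfies `e ≥ (2 - 1/k) (v - 1)`. -/
theorem card_edges_ge_of_minimal {k : ℕ} (hk : 2 ≤ k) {c : ℝ} (hc : 2 - 1 / ((k : ℝ) - 1) < c)
    {H : FiniteGraph} (hH : c ≤ H.density)
    (hmin : ∀ H' : FiniteGraph, H'.IsMinor H → Nat.card H'.V < Nat.card H.V → H'.density < c) :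
    (2 * k - 1) * Nat.card H.V ≤ k * H.graph.edgeSet.ncard + (2 * k - 1) := by
  classical
  have := Fintype.ofFinite H.V
  rw [le_density_iff] at hH
  have hX : ∀ X : Finset H.V, X.Nonempty → X ≠ Finset.univ →
      ((H.graph.edgesIn X).card : ℝ) < c * X.card := by
    intro X hX hXu
    obtain ⟨H', hminor, hcard, he⟩ := H.exists_minor_induce X hX
    have hlt : X.card < Nat.card H.V := by
      rw [Nat.card_eq_fintype_card]
      exact Finset.card_lt_univ_of_notMem
        (Classical.not_forall.1 fun h => hXu (Finset.eq_univ_iff_forall.2 h)).choose_spec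
    have := density_lt_iff.1 (hmin H' hminor (hcard ▸ hlt))
    rw [hcard] at this
    refine lt_of_le_of_lt ?_ this
    exact_mod_cast he
  rw [SimpleGraph.edgeSet_ncard_eq_card_edgesIn] at hH ⊢
  rw [Nat.card_eq_fintype_card] at hH ⊢
  refine SimpleGraph.card_edgesIn_univ_ge hk ?_ ?_
  · -- A set left by no edge splits `H` into two parts, one of which is at least as dense.
    intro X hXne hXu
    by_contra! hno
    have hsub : H.graph.edgesIn Finset.univ ⊆ H.graph.edgesIn X ∪ H.graph.edgesIn Xᶜ := by
      intro e
      induction e with | _ a b =>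
      simp only [Finset.mem_union, SimpleGraph.mem_edgesIn, Finset.mem_compl]
      rintro ⟨-, hab⟩
      by_cases ha : a ∈ X <;> by_cases hb : b ∈ X
      · exact Or.inl ⟨⟨ha, hb⟩, hab⟩
      · exact absurd hab (hno a ha b hb)
      · exact absurd hab.symm (hno b hb a ha)
      · exact Or.inr ⟨⟨ha, hb⟩, hab⟩
    have h1 := (Finset.card_le_card hsub).trans (Finset.card_union_le _ _)
    have h2 := hX X hXne hXu
    have h3 := hX Xᶜ (by rwa [Finset.nonempty_iff_ne_empty, Ne, Finset.compl_eq_empty_iff])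
      (by rw [Ne, Finset.compl_eq_univ_iff]; exact hXne.ne_empty)
    have h4 : (X.card : ℝ) + Xᶜ.card = Fintype.card H.V := by
      exact_mod_cast Finset.card_add_card_compl X
    have h5 : ((H.graph.edgesIn Finset.univ).card : ℝ) ≤
        (H.graph.edgesIn X).card + (H.graph.edgesIn Xᶜ).card := by exact_mod_cast h1
    rw [← h4] at hH
    linarith
  · intro Z hconn hZ2 hZk hZ
    obtain ⟨H', hminor, hcard, he⟩ := H.exists_minor_contract_finset Z hconn hZ
    have hlt := density_lt_iff.1 (hmin H' hminor (by omega))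
    rw [SimpleGraph.edgeSet_ncard_eq_card_edgesIn] at he
    rw [Nat.card_eq_fintype_card (α := H.V)] at hcard
    obtain ⟨j, hj⟩ : ∃ j, Z.card = j + 1 := ⟨Z.card - 1, by omega⟩
    have hj1 : (1 : ℝ) ≤ j := by exact_mod_cast (by omega : 1 ≤ j)
    have hjk : (j : ℝ) ≤ k - 1 := by
      rw [le_sub_iff_add_le]
      exact_mod_cast (by omega : j + 1 ≤ k)
    have hcardR : (Fintype.card H.V : ℝ) = Nat.card H'.V + j := by
      exact_mod_cast (by omega : Fintype.card H.V = Nat.card H'.V + j)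
    have heR : ((H.graph.edgesIn Finset.univ).card : ℝ) ≤
        H'.graph.edgeSet.ncard + (H.graph.edgesIn Z).card := by exact_mod_cast he
    rw [hcardR] at hH
    -- `Z` contains more than `c * j > 2 * j - j / (k - 1) ≥ 2 * j - 1` edges.
    have h1 : c * j < (H.graph.edgesIn Z).card := by linarith
    have h2 : (2 - 1 / ((k : ℝ) - 1)) * j ≤ c * j :=
      mul_le_mul_of_nonneg_right hc.le (by linarith)
    have h3 : 1 / ((k : ℝ) - 1) * j ≤ 1 := by
      rw [one_div_mul_eq_div]
      exact div_le_one_of_le₀ hjk (by linarith)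
    have h4 : 2 * (j : ℝ) < (H.graph.edgesIn Z).card + 1 := by linarith
    have h5 : 2 * j < (H.graph.edgesIn Z).card + 1 := by exact_mod_cast h4
    omega

/-- Passing to a member with the fewest vertices among those at least as dense as `G`. -/
theorem IsMinorClosed.exists_dense {A : Set FiniteGraph} (hA : IsMinorClosed A) {k : ℕ}
    (hk : 2 ≤ k) {G : FiniteGraph} (hG : G ∈ A) (hGk : 2 - 1 / ((k : ℝ) - 1) < G.density) :
    ∃ H ∈ A, G.density ≤ H.density ∧
      (2 * k - 1) * Nat.card H.V ≤ k * H.graph.edgeSet.ncard + (2 * k - 1) := by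
  obtain ⟨H, ⟨hHA, hH⟩, hmin⟩ := (measure fun H : FiniteGraph => Nat.card H.V).wf.has_min
    {H | H ∈ A ∧ G.density ≤ H.density} ⟨G, hG, le_rfl⟩
  refine ⟨H, hHA, hH, card_edges_ge_of_minimal hk hGk hH fun H' hminor hlt => ?_⟩
  by_contra! h
  exact hmin H' ⟨hA H hHA H' hminor, h⟩ hlt

/-- A critical density strictly inside the interval is attained by a graph with
`e ≥ (2 - 1/k) (v - 1)`, since only finitely many densities at most `β < 2 - 1/k` come from such
graphs. -/
theorem IsMinorClosed.exists_density_eq {A : Set FiniteGraph} (hA : IsMinorClosed A)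
    (hne : A.Nonempty) {k : ℕ}
    (hk : 2 ≤ k) (hlow : 2 - 1 / ((k : ℝ) - 1) < criticalDensity A)
    (hup : criticalDensity A < 2 - 1 / (k : ℝ)) :
    ∃ H ∈ A, H.density = criticalDensity A ∧
      (2 * k - 1) * Nat.card H.V ≤ k * H.graph.edgeSet.ncard + (2 * k - 1) := by
  have hk1 : (1 : ℝ) ≤ (k : ℝ) - 1 := by
    have : (2 : ℝ) ≤ k := by exact_mod_cast hk
    linarith
  have hpos : 0 < criticalDensity A := by
    have : 1 / ((k : ℝ) - 1) ≤ 1 := div_le_one_of_le₀ hk1 (by linarith)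
    linarith
  -- The real supremum of an unbounded set would be `0`.
  have hbdd : BddAbove (density '' A) := by
    by_contra h
    rw [criticalDensity, Real.sSup_of_not_bddAbove h] at hpos
    exact lt_irrefl _ hpos
  have hle : ∀ G ∈ A, G.density ≤ criticalDensity A := fun G hG =>
    le_csSup hbdd (Set.mem_image_of_mem _ hG)
  let S : Set FiniteGraph := {H | H ∈ A ∧
    (2 * k - 1) * Nat.card H.V ≤ k * H.graph.edgeSet.ncard + (2 * k - 1)}
  have hfin : (density '' S).Finite := by
    obtain ⟨M, hM⟩ := exists_nat_gt
      ((2 * (k : ℝ) - 1) / (2 * (k : ℝ) - 1 - k * criticalDensity A))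
    refine ((Set.finite_Iic (2 * M)).prod (Set.finite_Iic M)).image
      (fun p : ℕ × ℕ => (p.1 : ℝ) / p.2) |>.subset ?_
    rintro _ ⟨H, ⟨hHA, hH⟩, rfl⟩
    have hd : 0 < 2 * (k : ℝ) - 1 - k * criticalDensity A := by
      have := mul_lt_mul_of_pos_left hup (by linarith : (0 : ℝ) < k)
      rw [mul_sub, mul_one_div_cancel (by linarith)] at this
      linarith
    have he : (H.graph.edgeSet.ncard : ℝ) ≤ criticalDensity A * Nat.card H.V :=
      (div_le_iff₀ H.card_pos).1 (hle H hHA)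
    have hHR : (2 * (k : ℝ) - 1) * Nat.card H.V ≤
        k * H.graph.edgeSet.ncard + (2 * (k : ℝ) - 1) := by
      have : ((2 * k - 1 : ℕ) : ℝ) = 2 * (k : ℝ) - 1 := by
        rw [Nat.cast_sub (by omega)]
        simp
      rw [← this]
      exact_mod_cast hH
    have hv : (Nat.card H.V : ℝ) < M := by
      refine lt_of_le_of_lt ?_ hM
      rw [le_div_iff₀ hd]
      have := mul_le_mul_of_nonneg_left he (by linarith : (0 : ℝ) ≤ k)
      linarith
    have heM : (H.graph.edgeSet.ncard : ℝ) ≤ 2 * M := by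
      have h0 : (0 : ℝ) ≤ 1 / k := by positivity
      have h2 : criticalDensity A * Nat.card H.V ≤ 2 * Nat.card H.V :=
        mul_le_mul_of_nonneg_right (by linarith) H.card_pos.le
      linarith
    refine ⟨(H.graph.edgeSet.ncard, Nat.card H.V), ⟨?_, ?_⟩, rfl⟩
    · exact_mod_cast heM
    · exact_mod_cast hv.le
  obtain ⟨_, ⟨G, hG, rfl⟩, hGlow⟩ := exists_lt_of_lt_csSup (hne.image _) hlow
  obtain ⟨H₀, hH₀A, hGH₀, hH₀⟩ := hA.exists_dense hk hG hGlow
  obtain ⟨_, ⟨H, ⟨hHA, hH⟩, rfl⟩, hmax⟩ :=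
    Set.exists_max_image (density '' S) id hfin ⟨_, H₀, ⟨hH₀A, hH₀⟩, rfl⟩
  have hHmax : ∀ F ∈ S, F.density ≤ H.density := fun F hF => hmax _ ⟨F, hF, rfl⟩
  refine ⟨H, hHA, le_antisymm (hle H hHA) (csSup_le (hne.image _) ?_), hH⟩
  rintro _ ⟨F, hF, rfl⟩
  by_cases hFlow : 2 - 1 / ((k : ℝ) - 1) < F.density
  · obtain ⟨F', hF'A, hFF', hF'⟩ := hA.exists_dense hk hF hFlow
    exact hFF'.trans (hHmax F' ⟨hF'A, hF'⟩)
  · exact (not_lt.1 hFlow).trans (hGlow.le.trans (hGH₀.trans (hHmax H₀ ⟨hH₀A, hH₀⟩)))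

/-! ### The arithmetic of the parametrized densities -/

/-- If `d = (2k - 1) v - k e` lies between `1` and `2k - 1`, then scaling `v` and `e` by an integer
`r` with `k ≤ d r ≤ 2k - 1` brings the density `e / v` into the parametrized form. -/
theorem exists_params {k : ℕ} (hk : 2 ≤ k) {v e : ℕ} (hv : 0 < v)
    (hlow : 2 - 1 / ((k : ℝ) - 1) < (e : ℝ) / v) (hup : (e : ℝ) / v < 2 - 1 / (k : ℝ))
    (he : (2 * k - 1) * v ≤ k * e + (2 * k - 1)) :
    ∃ n m t : ℕ, 1 ≤ m ∧ t ≤ k - 1 ∧ n = m * k + 1 + t ∧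
      (2 * (k : ℝ) - 1 - (t : ℝ)) * ((k : ℝ) - 1) < (n : ℝ) ∧
      (e : ℝ) / v = 2 - 1 / (k : ℝ) - (2 * (k : ℝ) - (t : ℝ) - 1) / ((k : ℝ) * (n : ℝ)) := by
  have hvR : (0 : ℝ) < v := by exact_mod_cast hv
  have hkR : (2 : ℝ) ≤ k := by exact_mod_cast hk
  have hk0 : (k : ℝ) ≠ 0 := by linarith
  have hk10 : (k : ℝ) - 1 ≠ 0 := by linarith
  obtain ⟨d, hd⟩ : ∃ d : ℕ, (2 * k - 1) * v = k * e + d := by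
    refine ⟨(2 * k - 1) * v - k * e, ?_⟩
    rw [div_lt_iff₀ hvR] at hup
    have h1 := mul_lt_mul_of_pos_left hup (by linarith : (0 : ℝ) < k)
    rw [← mul_assoc, mul_sub, mul_one_div_cancel hk0] at h1
    have h2 : ((k * e : ℕ) : ℝ) < ((2 * k - 1) * v : ℕ) := by
      push_cast [Nat.cast_sub (by omega : 1 ≤ 2 * k)]
      linarith
    have h3 : k * e < (2 * k - 1) * v := by exact_mod_cast h2
    omega
  have hdR : (2 * (k : ℝ) - 1) * v = k * e + d := by
    have : (((2 * k - 1) * v : ℕ) : ℝ) = (k * e + d : ℕ) := by rw [hd]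
    push_cast [Nat.cast_sub (by omega : 1 ≤ 2 * k)] at this
    exact this
  have hd0 : 0 < d := by
    rw [div_lt_iff₀ hvR] at hup
    have h1 := mul_lt_mul_of_pos_left hup (by linarith : (0 : ℝ) < k)
    rw [← mul_assoc, mul_sub, mul_one_div_cancel hk0] at h1
    have : (0 : ℝ) < d := by linarith
    exact_mod_cast this
  have hdk : d ≤ 2 * k - 1 := by omega
  obtain ⟨r, hr1, hr2⟩ : ∃ r, k ≤ d * r ∧ d * r ≤ 2 * k - 1 := by
    by_cases hdk' : k ≤ d
    · exact ⟨1, by omega, by omega⟩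
    · refine ⟨k / d + 1, ?_, ?_⟩
      · have := Nat.lt_mul_div_succ k hd0
        omega
      · have := Nat.mul_div_le k d
        rw [mul_add]
        omega
  have hr0 : 0 < r := Nat.pos_of_ne_zero (by rintro rfl; omega)
  -- In terms of `d`, the lower bound on the density is a lower bound on `v`.
  have hvd : (d : ℝ) * (k - 1) < v := by
    rw [lt_div_iff₀ hvR] at hlow
    have h1 := mul_lt_mul_of_pos_left hlow (by nlinarith : (0 : ℝ) < k * (k - 1))
    have h2 : (k : ℝ) * (k - 1) * ((2 - 1 / (k - 1)) * v) = (k * (k - 1) * 2 - k) * v := by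
      field_simp
    rw [h2] at h1
    have h3 : (k : ℝ) * (k - 1) * e = (k - 1) * ((2 * (k : ℝ) - 1) * v - d) := by
      rw [hdR]
      ring
    nlinarith
  have hvdr : (d * r : ℕ) * ((k : ℝ) - 1) < (r * v : ℕ) := by
    have : (0 : ℝ) < r := by exact_mod_cast hr0
    push_cast
    nlinarith
  have hvdr' : d * r * (k - 1) < r * v := by
    have : ((d * r * (k - 1) : ℕ) : ℝ) < (r * v : ℕ) := by
      push_cast [Nat.cast_sub (by omega : 1 ≤ k)]
      push_cast at hvdr
      exact hvdr
    exact_mod_cast this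
  obtain ⟨q, rfl⟩ : ∃ q, k = q + 1 := ⟨k - 1, by omega⟩
  obtain ⟨t, ht⟩ : ∃ t, d * r + t = 2 * q + 1 := ⟨2 * q + 1 - d * r, by omega⟩
  have hdvd : r * v + d * r = (q + 1) * (2 * r * v - r * e) := by
    have h1 : (2 * q + 1) * v = (q + 1) * e + d := hd
    have h2 : r * e ≤ 2 * r * v := by nlinarith
    zify [h2] at h1 ⊢
    linear_combination -r * h1
  obtain ⟨p, hp⟩ : ∃ p, r * v + d * r = (q + 1) * p := ⟨_, hdvd⟩
  have hp3 : 3 ≤ p := by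
    by_contra! hlt
    have h1 : (q + 1) * p ≤ (q + 1) * 2 := Nat.mul_le_mul_left _ (by omega)
    have h2 : d * r * 1 ≤ d * r * (q + 1 - 1) := Nat.mul_le_mul_left _ (by omega)
    omega
  refine ⟨r * v, p - 2, t, by omega, by omega, ?_, ?_, ?_⟩
  · obtain ⟨p', rfl⟩ : ∃ p', p = p' + 2 := ⟨p - 2, by omega⟩
    rw [Nat.add_sub_cancel]
    have h1 : (q + 1) * (p' + 2) = p' * (q + 1) + (q + 1) * 2 := by ring
    omega
  · have : (d * r : ℕ) = 2 * ((q + 1 : ℕ) : ℝ) - 1 - t := by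
      have : ((d * r + t : ℕ) : ℝ) = (2 * q + 1 : ℕ) := by rw [ht]
      push_cast at this ⊢
      linarith
    rw [← this]
    exact hvdr
  · have h1 : 2 * ((q + 1 : ℕ) : ℝ) - t - 1 = d * r := by
      have : ((d * r + t : ℕ) : ℝ) = (2 * q + 1 : ℕ) := by rw [ht]
      push_cast at this ⊢
      linarith
    have hrR : (r : ℝ) ≠ 0 := by exact_mod_cast hr0.ne'
    rw [h1, Nat.cast_mul]
    field_simp
    linarith

end FiniteGraph

/-! ### Joins of a vertex with disjoint paths -/

namespace FiniteGraph

/-- The position `q` immediately follows the position `p` on the same path. -/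
def Follows {m : ℕ} {s : Fin m → ℕ} (p q : Σ i, Fin (s i)) : Prop :=
  p.1 = q.1 ∧ (p.2 : ℕ) + 1 = q.2

theorem position_ext {m : ℕ} {s : Fin m → ℕ} {p q : Σ i, Fin (s i)} (h : p.1 = q.1)
    (h' : (p.2 : ℕ) = q.2) : p = q := by
  obtain ⟨i, a⟩ := p
  obtain ⟨j, b⟩ := q
  obtain rfl : i = j := h
  obtain rfl : a = b := Fin.ext h'
  rfl

/-- The join of a single vertex, the hub `none`, with the disjoint union of `m` paths, the `i`-th
one having `s i` vertices. -/
def pathFan {m : ℕ} (s : Fin m → ℕ) : FiniteGraph where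
  V := Option (Σ i, Fin (s i))
  graph := SimpleGraph.fromRel fun x y => match x, y with
    | none, some _ => True
    | some p, some q => Follows p q
    | _, none => False

section pathFan

variable {m : ℕ} {s : Fin m → ℕ}

theorem pathFan_adj_none_some (p : Σ i, Fin (s i)) :
    (pathFan s).graph.Adj (none : Option (Σ i, Fin (s i))) (some p) :=
  ⟨by simp, Or.inl trivial⟩

theorem pathFan_adj_some_some {p q : Σ i, Fin (s i)} :
    (pathFan s).graph.Adj (some p : Option (Σ i, Fin (s i))) (some q) ↔
      Follows p q ∨ Follows q p := by
  refine ⟨fun h => h.2, fun h => ⟨?_, h⟩⟩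
  intro hpq
  obtain rfl := Option.some_injective _ hpq
  obtain ⟨-, h⟩ | ⟨-, h⟩ := h <;> omega

theorem card_pathFan (s : Fin m → ℕ) : Nat.card (pathFan s).V = ∑ i, s i + 1 := by
  change Nat.card (Option (Σ i, Fin (s i))) = _
  simp [Nat.card_eq_fintype_card]

theorem pathFan_edges_ge (hs : ∀ i, 1 ≤ s i) :
    2 * ∑ i, s i ≤ (pathFan s).graph.edgeSet.ncard + m := by
  let lo : (Σ i, Fin (s i - 1)) → Σ i, Fin (s i) :=
    Sigma.map id fun i => Fin.castLE (Nat.sub_le _ _)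
  let hi : (Σ i, Fin (s i - 1)) → Σ i, Fin (s i) := fun p => ⟨p.1, p.2 + 1, by omega⟩
  have hlo : lo.Injective :=
    Function.injective_id.sigma_map fun i => Fin.castLE_injective (Nat.sub_le _ _)
  have hval : ∀ p, (lo p).2.val + 1 = (hi p).2.val := fun _ => rfl
  let f : (Σ i, Fin (s i)) ⊕ (Σ i, Fin (s i - 1)) → Sym2 (Option (Σ i, Fin (s i))) :=
    Sum.elim (fun p => s(none, some p)) (fun p => s(some (lo p), some (hi p)))
  have hf : f.Injective := by
    refine Function.Injective.sumElim ?_ ?_ ?_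
    · intro p q hpq
      exact Option.some_injective _ (Sym2.congr_right.1 hpq)
    · intro p q hpq
      rcases Sym2.eq_iff.1 hpq with ⟨h, -⟩ | ⟨h1, h2⟩
      · exact hlo (Option.some_injective _ h)
      · have h3 : (lo p).2.val = (hi q).2.val := by rw [Option.some_injective _ h1]
        have h4 : (hi p).2.val = (lo q).2.val := by rw [Option.some_injective _ h2]
        have hp := hval p
        have hq := hval q
        omega
    · intro p q hpq
      rcases Sym2.eq_iff.1 hpq with ⟨h, -⟩ | ⟨h, -⟩ <;> exact Option.some_ne_none _ h.symm
  have hrange : Set.range f ⊆ (pathFan s).graph.edgeSet := by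
    rintro _ ⟨p | p, rfl⟩
    · exact pathFan_adj_none_some p
    · exact pathFan_adj_some_some.2 (Or.inl ⟨rfl, rfl⟩)
  have h1 : (Set.range f).ncard ≤ (pathFan s).graph.edgeSet.ncard :=
    Set.ncard_le_ncard hrange (Set.toFinite (pathFan s).graph.edgeSet)
  rw [← Set.image_univ, Set.ncard_image_of_injective _ hf, Set.ncard_univ,
    Nat.card_eq_fintype_card] at h1
  simp only [Fintype.card_sum, Fintype.card_sigma, Fintype.card_fin] at h1
  have h2 : ∑ i, (s i - 1) + m = ∑ i, s i := by
    have : ∑ i, s i = ∑ i, ((s i - 1) + 1) :=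
      Finset.sum_congr rfl fun i _ => by have := hs i; omega
    rw [this, Finset.sum_add_distrib]
    simp
  omega

/-- The shape of a minor of a path fan. Removing the vertex whose branch set contains the hub leaves
`n i ≤ s i` vertices on the `i`-th path, and these span a linear forest in which each of the paths
that are used, those with `i ∈ I`, accounts for at least one component. -/
theorem IsMinor.pathFan_count {H : FiniteGraph} (hH : H.IsMinor (pathFan s)) :
    ∃ (I : Finset (Fin m)) (n : Fin m → ℕ), (∀ i, n i ≤ s i) ∧
      ((Nat.card H.V = ∑ i ∈ I, n i + 1 ∧
          H.graph.edgeSet.ncard + I.card ≤ 2 * ∑ i ∈ I, n i) ∨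
        (Nat.card H.V = ∑ i ∈ I, n i ∧ H.graph.edgeSet.ncard + I.card ≤ ∑ i ∈ I, n i)) := by
  classical
  obtain ⟨B, hconn, hdis, hadj⟩ := hH
  have := Fintype.ofFinite H.V
  change H.V → Set (Option (Σ i, Fin (s i))) at B
  have huniq : ∀ x y v, v ∈ B x → v ∈ B y → x = y := fun x y v hx hy => by
    by_contra h
    exact Set.disjoint_left.1 (hdis x y h) hx hy
  let W : Finset H.V := {x | none ∉ B x}
  have hW : ∀ x, x ∈ W ↔ none ∉ B x := by simp [W]
  have hex : ∀ x : W, ∃ p, some p ∈ B x := by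
    rintro ⟨x, hx⟩
    obtain ⟨⟨_ | p, hp⟩⟩ := (hconn x).nonempty
    · exact absurd hp ((hW x).1 hx)
    · exact ⟨p, hp⟩
  choose rep hrep using hex
  -- A branch set avoiding the hub lies on one path, and a place where it ends is its last one.
  have hpath : ∀ x ∈ W, ∀ p q, some p ∈ B x → some q ∈ B x → p.1 = q.1 := by
    intro x hx p q hp hq
    refine (hconn x).induce_induction (P := fun v : Option (Σ i, Fin (s i)) =>
      ∀ q, v = some q → p.1 = q.1) hp ?_ ?_ (some q) hq q rfl
    · rintro q hpq
      rw [Option.some_injective _ hpq]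
    · rintro (_ | u) hu v hv huv hP q rfl
      · exact absurd hu ((hW x).1 hx)
      · rw [hP u rfl]
        rcases pathFan_adj_some_some.1 huv with h | h
        · exact h.1
        · exact h.1.symm
  have hlast : ∀ x ∈ W, ∀ p q p', some p ∈ B x → some q ∉ B x → Follows p q → some p' ∈ B x →
      (p'.2 : ℕ) ≤ p.2 := by
    intro x hx p q p' hp hq hpq hp'
    refine (hconn x).induce_induction (P := fun v : Option (Σ i, Fin (s i)) =>
      ∀ p', v = some p' → (p'.2 : ℕ) ≤ p.2) hp ?_ ?_ (some p') hp' p' rfl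
    · rintro q hpq
      rw [Option.some_injective _ hpq]
    · rintro (_ | u) hu v hv huv hP p' rfl
      · exact absurd hu ((hW x).1 hx)
      · have hup := hP u rfl
        rcases pathFan_adj_some_some.1 huv with h | h
        · by_contra! hlt
          have : p' = q := position_ext ((hpath x hx _ _ hv hp).trans hpq.1) (by
            have h1 := h.2
            have h2 := hpq.2
            omega)
          exact hq (this ▸ hv)
        · have := h.2
          omega
  let R : W → W → Prop := fun x y => x ≠ y ∧ ∃ p q, some p ∈ B x ∧ some q ∈ B y ∧ Follows p q
  have hnot : ∀ x y : W, x ≠ y → ∀ v, v ∈ B y → v ∉ B x := fun x y hxy v hy hx =>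
    hxy (Subtype.ext (huniq x y v hx hy))
  have hRfun : ∀ x y y', R x y → R x y' → y = y' := by
    rintro x y y' ⟨hxy, p, q, hp, hq, hpq⟩ ⟨hxy', p', q', hp', hq', hpq'⟩
    have h1 := hlast x x.2 p q p' hp (hnot x y hxy _ hq) hpq hp'
    have h2 := hlast x x.2 p' q' p hp' (hnot x y' hxy' _ hq') hpq' hp
    have h3 := hpath x x.2 p p' hp hp'
    have : q = q' := position_ext (hpq.1.symm.trans (h3.trans hpq'.1)) (by
      have h1 := hpq.2
      have h2 := hpq'.2
      omega)
    exact Subtype.ext (huniq y y' _ hq (this ▸ hq'))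
  let D : Finset W := {x | ∃ y, R x y}
  let idx : W → Fin m := fun x => (rep x).1
  let I : Finset (Fin m) := Finset.univ.image idx
  have hDI : D.card + I.card ≤ W.card := by
    have hsub : I ⊆ Dᶜ.image idx := by
      intro i hi
      obtain ⟨x₀, -, rfl⟩ := Finset.mem_image.1 hi
      -- The branch set containing the last covered position of a path has no successor.
      obtain ⟨p, hp, hpmax⟩ := Finset.exists_max_image
        ({p | p.1 = idx x₀ ∧ ∃ x : W, some p ∈ B x} : Finset (Σ i, Fin (s i)))
        (fun p => (p.2 : ℕ)) ⟨rep x₀, by simpa [idx] using ⟨x₀, x₀.2, hrep x₀⟩⟩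
      simp only [Finset.mem_filter, Finset.mem_univ, true_and] at hp hpmax
      obtain ⟨hpi, x, hpx⟩ := hp
      refine Finset.mem_image.2 ⟨x, ?_, (hpath x x.2 _ _ (hrep x) hpx).trans hpi⟩
      simp only [D, Finset.mem_compl, Finset.mem_filter, Finset.mem_univ, true_and]
      rintro ⟨y, hxy, p', q, hp', hq, hpq⟩
      have h1 := hlast x x.2 p' q p hp' (hnot x y hxy _ hq) hpq hpx
      have h2 := hpmax q ⟨hpq.1.symm.trans ((hpath x x.2 _ _ hp' hpx).trans hpi), y, hq⟩
      have h3 := hpq.2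
      omega
    have h1 := (Finset.card_le_card hsub).trans Finset.card_image_le
    have h2 := D.card_add_card_compl
    rw [Fintype.card_coe] at h2
    omega
  let E : Set (Sym2 H.V) := {e ∈ H.graph.edgeSet | ∀ v ∈ e, v ∈ W}
  have hE : E.ncard ≤ D.card := by
    have hnext : ∀ x : W, ∃ y : H.V, ∀ y', R x y' → y = y' := by
      intro x
      by_cases h : ∃ y, R x y
      · obtain ⟨y, hy⟩ := h
        exact ⟨y, fun y' hy' => congrArg _ (hRfun x y y' hy hy')⟩
      · exact ⟨x, fun y' hy' => absurd ⟨y', hy'⟩ h⟩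
    choose next hnext using hnext
    have hsub : E ⊆ (fun x : W => s((x : H.V), next x)) '' (D : Set W) := by
      intro e
      induction e with | _ x y =>
      rintro ⟨hxy, hmem⟩
      have hx : x ∈ W := hmem x (Sym2.mem_mk_left _ _)
      have hy : y ∈ W := hmem y (Sym2.mem_mk_right _ _)
      have hne : x ≠ y := H.graph.ne_of_adj hxy
      obtain ⟨u, hu, v, hv, huv⟩ := hadj x y hxy
      obtain _ | p := u
      · exact absurd hu ((hW x).1 hx)
      obtain _ | q := v
      · exact absurd hv ((hW y).1 hy)
      rcases pathFan_adj_some_some.1 huv with h | h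
      · have hR : R ⟨x, hx⟩ ⟨y, hy⟩ := ⟨by simpa using hne, p, q, hu, hv, h⟩
        exact ⟨⟨x, hx⟩, by simp only [D, Finset.coe_filter, Finset.mem_univ, true_and]; exact ⟨_, hR⟩,
          by simp only [hnext _ _ hR]⟩
      · have hR : R ⟨y, hy⟩ ⟨x, hx⟩ := ⟨by simpa using hne.symm, q, p, hv, hu, h⟩
        exact ⟨⟨y, hy⟩, by simp only [D, Finset.coe_filter, Finset.mem_univ, true_and]; exact ⟨_, hR⟩,
          by simp only [hnext _ _ hR]; exact Sym2.eq_swap⟩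
    refine (Set.ncard_le_ncard hsub (Set.toFinite _)).trans ?_
    rw [← Set.ncard_coe_finset D]
    exact Set.ncard_image_le (Set.toFinite _)
  let n : Fin m → ℕ := fun i => (Finset.univ.filter fun x : W => idx x = i).card
  have hsum : ∑ i ∈ I, n i = W.card := by
    rw [← Fintype.card_coe W, ← Finset.card_univ]
    exact (Finset.card_eq_sum_card_image idx _).symm
  refine ⟨I, n, fun i => ?_, ?_⟩
  · have hinj : Set.InjOn rep (Finset.univ.filter fun x : W => idx x = i : Finset W) := by
      intro x _ y _ hxy
      exact Subtype.ext (huniq x y _ (hrep x) (hxy ▸ hrep y))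
    rw [← Fintype.card_fin (s i), ← Finset.card_univ,
      ← Finset.card_map (Function.Embedding.sigmaMk (β := fun i => Fin (s i)) i)]
    refine Finset.card_le_card_of_injOn rep ?_ hinj
    intro x hx
    obtain rfl : idx x = i := by simpa using hx
    simp only [Finset.coe_map, Finset.coe_univ, Set.image_univ]
    exact ⟨(rep x).2, rfl⟩
  · rw [hsum]
    by_cases hhub : ∃ h, none ∈ B h
    · obtain ⟨h, hh⟩ := hhub
      left
      have hnW : h ∉ W := fun hW' => (hW h).1 hW' hh
      have hins : insert h W = Finset.univ := by
        ext x
        simp only [Finset.mem_insert, Finset.mem_univ, iff_true, hW]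
        by_cases hx : none ∈ B x
        · exact Or.inl (huniq x h _ hx hh)
        · exact Or.inr hx
      refine ⟨?_, ?_⟩
      · rw [Nat.card_eq_fintype_card, ← Finset.card_univ, ← hins, Finset.card_insert_of_notMem hnW]
      · have hsub : H.graph.edgeSet ⊆ E ∪ (fun x => s(h, x)) '' (W : Set H.V) := by
          have hWiff : ∀ x, x ∈ W ∨ x = h := fun x => by
            have : x ∈ insert h W := hins ▸ Finset.mem_univ x
            simpa [or_comm] using this
          intro e
          induction e with | _ x y =>
          intro hxy
          have hne : x ≠ y := H.graph.ne_of_adj hxy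
          rcases hWiff x with hx | rfl
          · rcases hWiff y with hy | rfl
            · refine Or.inl ⟨hxy, fun v hv => ?_⟩
              rcases Sym2.mem_iff.1 hv with rfl | rfl <;> assumption
            · exact Or.inr ⟨x, hx, Sym2.eq_swap⟩
          · exact Or.inr ⟨y, (hWiff y).resolve_right hne.symm, rfl⟩
        have h1 := (Set.ncard_le_ncard hsub (Set.toFinite _)).trans (Set.ncard_union_le _ _)
        have h2 := Set.ncard_image_le (f := fun x => s(h, x)) (W : Set H.V).toFinite
        rw [Set.ncard_coe_finset] at h2
        omega
    · right
      have huniv : W = Finset.univ := by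
        ext x
        simp only [hW, Finset.mem_univ, iff_true]
        exact fun hx => hhub ⟨x, hx⟩
      refine ⟨?_, ?_⟩
      · rw [Nat.card_eq_fintype_card, huniv, Finset.card_univ]
      · have hsub : H.graph.edgeSet ⊆ E := fun e he => ⟨he, fun v _ => by simp [huniv]⟩
        have := Set.ncard_le_ncard hsub (Set.toFinite _)
        omega

theorem isMinor_refl (G : FiniteGraph) : G.IsMinor G :=
  ⟨fun v => {v}, fun v => G.graph.induce_singleton_connected v,
    fun _ _ h => Set.disjoint_singleton.2 h, fun x y h => ⟨x, rfl, y, rfl, h⟩⟩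

/-- Let `S = ∑ i, s i`, `ρ = (2S - m) / (S + 1)` and `q = 2 - ρ = (m + 2) / (S + 1)`. A minor with
`n i` vertices on the `i`-th path for `i ∈ I`, and one more vertex, satisfies
`e - ρ v ≤ ∑ i ∈ I, (q (n i) - 1) - ρ`. The first hypothesis says that `q (s i) - 1 ≥ 0`, so the sum
is largest when all paths are used in full, and then it equals `ρ`. The second one says that `ρ ≥ 1`,
which suffices for minors that avoid the hub. -/
theorem IsMinor.density_le_pathFan (hs : ∀ i, ∑ i, s i + 1 ≤ (m + 2) * s i)
    (hm : m + 1 ≤ ∑ i, s i) {H : FiniteGraph} (hH : H.IsMinor (pathFan s)) :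
    H.density ≤ (2 * ((∑ i, s i : ℕ) : ℝ) - m) / ((∑ i, s i : ℕ) + 1) := by
  obtain ⟨I, n, hn, hcount⟩ := hH.pathFan_count
  set S := ∑ i, s i with hS
  have hS1 : (0 : ℝ) < S + 1 := by positivity
  have hmS : (m : ℝ) + 1 ≤ S := by exact_mod_cast hm
  rw [density, div_le_div_iff₀ H.card_pos hS1]
  rcases hcount with ⟨hv, he⟩ | ⟨hv, he⟩
  · have hterm : ∑ i ∈ I, (((m : ℝ) + 2) * n i - (S + 1)) ≤
        ∑ i, (((m : ℝ) + 2) * s i - (S + 1)) := by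
      refine (Finset.sum_le_sum fun i _ => ?_).trans
        (Finset.sum_le_sum_of_subset_of_nonneg I.subset_univ fun i _ _ => ?_)
      · have : (n i : ℝ) ≤ s i := by exact_mod_cast hn i
        gcongr
      · have : (S : ℝ) + 1 ≤ (m + 2) * s i := by exact_mod_cast hs i
        linarith
    rw [Finset.sum_sub_distrib, Finset.sum_sub_distrib, ← Finset.mul_sum, ← Finset.mul_sum] at hterm
    simp only [Finset.sum_const, Finset.card_univ, Fintype.card_fin, nsmul_eq_mul] at hterm
    have hSR : ∑ i, (s i : ℝ) = S := by rw [hS]; push_cast; rfl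
    have heR : (H.graph.edgeSet.ncard : ℝ) + I.card ≤ 2 * ∑ i ∈ I, (n i : ℝ) := by
      exact_mod_cast he
    rw [hSR] at hterm
    rw [hv]
    push_cast
    have := mul_le_mul_of_nonneg_right heR hS1.le
    linarith
  · have heR : (H.graph.edgeSet.ncard : ℝ) ≤ Nat.card H.V := by
      rw [hv]
      exact_mod_cast (Nat.le_add_right _ _).trans he
    calc (H.graph.edgeSet.ncard : ℝ) * (S + 1) ≤ Nat.card H.V * (S + 1) := by gcongr
      _ ≤ Nat.card H.V * (2 * S - m) := by gcongr; linarith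
      _ = _ := mul_comm _ _

theorem pathFan_mem_achievable (hs : ∀ i, ∑ i, s i + 1 ≤ (m + 2) * s i)
    (hm : m + 1 ≤ ∑ i, s i) :
    (2 * ((∑ i, s i : ℕ) : ℝ) - m) / ((∑ i, s i : ℕ) + 1) ∈ achievableDensities := by
  have hden : (pathFan s).density = (2 * ((∑ i, s i : ℕ) : ℝ) - m) / ((∑ i, s i : ℕ) + 1) := by
    refine le_antisymm ((isMinor_refl _).density_le_pathFan hs hm) ?_
    have hs1 : ∀ i, 1 ≤ s i := fun i => Nat.one_le_iff_ne_zero.2 fun h => by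
      have := hs i
      rw [h] at this
      omega
    have he : 2 * ((∑ i, s i : ℕ) : ℝ) ≤ (pathFan s).graph.edgeSet.ncard + m := by
      exact_mod_cast pathFan_edges_ge hs1
    rw [density, card_pathFan]
    push_cast at he ⊢
    gcongr
    linarith
  exact ⟨pathFan s, fun H hH => hden ▸ hH.density_le_pathFan hs hm, hden⟩

end pathFan

end FiniteGraph

theorem theorem4 (k : ℕ) (hk : 2 ≤ k) :
    (∀ A : Set FiniteGraph, FiniteGraph.IsProper A → FiniteGraph.IsMinorClosed A →
      2 - 1 / ((k : ℝ) - 1) ≤ FiniteGraph.criticalDensity A →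
      FiniteGraph.criticalDensity A < 2 - 1 / (k : ℝ) →
        FiniteGraph.criticalDensity A = 2 - 1 / ((k : ℝ) - 1) ∨
        ∃ n m t : ℕ, 1 ≤ m ∧ t ≤ k - 1 ∧ n = m * k + 1 + t ∧
          (2 * (k : ℝ) - 1 - (t : ℝ)) * ((k : ℝ) - 1) < (n : ℝ) ∧
          FiniteGraph.criticalDensity A =
            2 - 1 / (k : ℝ) - (2 * (k : ℝ) - (t : ℝ) - 1) / ((k : ℝ) * (n : ℝ))) ∧
    2 - 1 / ((k : ℝ) - 1) ∈ FiniteGraph.achievableDensities ∧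
    (∀ n m t : ℕ, 1 ≤ m → t ≤ k - 1 → n = m * k + 1 + t →
      (2 * (k : ℝ) - 1 - (t : ℝ)) * ((k : ℝ) - 1) < (n : ℝ) →
        2 - 1 / (k : ℝ) - (2 * (k : ℝ) - (t : ℝ) - 1) / ((k : ℝ) * (n : ℝ)) ∈
          FiniteGraph.achievableDensities) := by
  refine ⟨fun A hA hclosed hlow hup => ?_, ?_, fun n m t hm ht hn _ => ?_⟩
  · rcases hlow.eq_or_lt with h | h
    · exact Or.inl h.symm
    · obtain ⟨H, -, hH, he⟩ := hclosed.exists_density_eq hA.1 hk h hup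
      rw [← hH] at h hup ⊢
      exact Or.inr (FiniteGraph.exists_params hk Nat.card_pos h hup he)
  · -- A single path on `3 (k - 1) - 1` vertices gives `n = 3 (k - 1)` vertices and `2 n - 3` edges.
    obtain ⟨j, rfl⟩ : ∃ j, k = j + 2 := ⟨k - 2, by omega⟩
    have h := FiniteGraph.pathFan_mem_achievable (s := fun _ : Fin 1 => 3 * j + 2) (by simp)
      (by simp)
    convert h using 1
    rw [show (((j + 2 : ℕ) : ℝ) - 1) = j + 1 by push_cast; ring]
    simp only [Finset.univ_unique, Finset.sum_const, Finset.card_singleton, one_smul]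
    push_cast
    rw [show 3 * (j : ℝ) + 2 + 1 = 3 * (j + 1) by ring]
    field_simp
    ring
  · obtain ⟨m, rfl⟩ : ∃ m', m = m' + 1 := ⟨m - 1, by omega⟩
    have hsum : ∑ i : Fin (m + 1), (if i = 0 then k + t else k) = (m + 1) * k + t := by
      simp [Fin.sum_univ_succ]
      ring
    have h := FiniteGraph.pathFan_mem_achievable (s := fun i : Fin (m + 1) => if i = 0 then k + t else k)
      (by
        intro i
        rw [hsum]
        have : (m + 1 + 2) * k ≤ (m + 1 + 2) * (if i = 0 then k + t else k) :=
          Nat.mul_le_mul_left _ (by split_ifs <;> omega)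
        refine le_trans ?_ this
        have : (m + 1 + 2) * k = (m + 1) * k + 2 * k := by ring
        omega)
      (by
        rw [hsum]
        nlinarith)
    rw [hsum] at h
    convert h using 1
    have hk0 : (k : ℝ) ≠ 0 := by positivity
    have hn0 : ((m : ℝ) + 1) * k + t + 1 ≠ 0 := by positivity
    rw [hn]
    push_cast
    rw [show ((m : ℝ) + 1) * k + 1 + t = (m + 1) * k + t + 1 by ring]
    field_simp
    ring
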